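/- Let $\{R_t\}_{t\ge 1}$ be a bandit with finite action set $\mathcal A$, that is, a stochastic process with values in $\mathbb R^{\mathcal A}$, and let $\alpha=\{\alpha_t\}_{t\ge 1}$ and $\{S_t\}_{t\ge 1}$ be stochastic processes on the same probability space, where each $\alpha_t$ and each $S_t$ takes values in a standard Borel space (which may depend on $t$). Write $X_{i:j}=(X_i,\dots,X_j)$, which is the empty tuple if $j<i$, and $X_{i:\infty}=(X_i,X_{i+1},\dots)$. Let $\mathbb I(\cdot\,;\cdot)$ and $\mathbb I(\cdot\,;\cdot\mid\cdot)$ denote mutual information and conditional mutual information, with values in $[0,\infty]$, and let $X\perp Y\mid Z$ denote conditional independence of $X$ and $Y$ given $Z$. For integers $T\ge 1$, the cumulative predictive information over $T$ timesteps is $$V_T(\alpha)=\sum_{t=0}^{T-1}\mathbb I\left(\alpha_{t+2:\infty};R_{t+1}\mid R_{1:t}\right).$$ Suppose that $\{S_t\}_{t\ge 1}$ is a Markov process such that $S_{t+1:\infty}\perp R_{1:t}\mid S_t$ for all integers $t\ge 1$, and $\alpha_{t+2:\infty}\perp R_{t+1}\mid (S_{t+2},R_{1:t})$ for all integers $t\ge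 0$. Then, for every integer $T\ge 1$, $$V_T(\alpha)\le \mathbb I(S_2;S_1)+\sum_{t=1}^{T-1}\mathbb I\left(S_{t+2};S_{t+1}\mid S_t\right).$$ -/

import Mathlib

open MeasureTheory ProbabilityTheory
open scoped ENNReal

noncomputable section

namespace PredictiveInformation

variable {Ω : Type*} [MeasurableSpace Ω]

/-- The block `X_{i:j} = (X_i, …, X_j)` of a stochastic process, as a random element of the product
space. For `j < i` it is the (unique) empty tuple. -/
def block {E : ℕ → Type*} (X : ∀ t, Ω → E t) (i j : ℕ) (ω : Ω) : ∀ k : Set.Icc i j, E k :=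
  fun k => X k ω

/-- The tail `X_{i:∞} = (X_i, X_{i+1}, …)` of a stochastic process. -/
def tail {E : ℕ → Type*} (X : ∀ t, Ω → E t) (i : ℕ) (ω : Ω) : ∀ k : Set.Ici i, E k :=
  fun k => X k ω

/-- The conditional probability `ℙ(X ∈ s | σ(Z))`, a random variable. -/
def condProb {β δ : Type*} [MeasurableSpace δ] (μ : Measure Ω) (X : Ω → β) (s : Set β)
    (Z : Ω → δ) : Ω → ℝ :=
  condExp (MeasurableSpace.comap Z inferInstance) μ ((X ⁻¹' s).indicator fun _ => (1 : ℝ))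

/-- Conditional independence `X ⊥ Y | Z` of random elements: for all measurable `s`, `t`,
`ℙ(X ∈ s, Y ∈ t | Z) = ℙ(X ∈ s | Z) ℙ(Y ∈ t | Z)` almost surely. (On a standard Borel `Ω` this is
`ProbabilityTheory.CondIndepFun`; here `Ω` is arbitrary.) -/
def CondIndepRV {β γ δ : Type*} [MeasurableSpace β] [MeasurableSpace γ] [MeasurableSpace δ]
    (μ : Measure Ω) (X : Ω → β) (Y : Ω → γ) (Z : Ω → δ) : Prop :=
  ∀ (s : Set β) (t : Set γ), MeasurableSet s → MeasurableSet t →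
    condProb μ (fun ω => (X ω, Y ω)) (s ×ˢ t) Z =ᵐ[μ]
      fun ω => condProb μ X s Z ω * condProb μ Y t Z ω

/-- A (not necessarily homogeneous) Markov process `S_1, S_2, …`: for all `t ≥ 1` and measurable
`s`, `ℙ(S_{t+1} ∈ s | S_1, …, S_t) = ℙ(S_{t+1} ∈ s | S_t)` almost surely. -/
def IsMarkovProcess {E : ℕ → Type*} [∀ t, MeasurableSpace (E t)] (μ : Measure Ω)
    (S : ∀ t, Ω → E t) : Prop :=
  ∀ t : ℕ, 1 ≤ t → ∀ s : Set (E (t + 1)), MeasurableSet s →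
    condProb μ (S (t + 1)) s (block S 1 t) =ᵐ[μ] condProb μ (S (t + 1)) s (S t)

/-- Mutual information `I(X; Y) = D(P_{X,Y} ‖ P_X ⊗ P_Y)`, in `[0, ∞]`. -/
def mutualInfo {β γ : Type*} [MeasurableSpace β] [MeasurableSpace γ]
    (μ : Measure Ω) (X : Ω → β) (Y : Ω → γ) : ℝ≥0∞ :=
  InformationTheory.klDiv (μ.map fun ω => (X ω, Y ω)) ((μ.map X).prod (μ.map Y))

/-- Conditional mutual information `I(X; Y | Z) = D(P_{Z,X,Y} ‖ P_Z P_{X|Z} P_{Y|Z})`, in `[0, ∞]`,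
where `P_{X|Z}` and `P_{Y|Z}` are regular conditional distributions. -/
def condMutualInfo {β γ δ : Type*} [MeasurableSpace β] [StandardBorelSpace β] [Nonempty β]
    [MeasurableSpace γ] [StandardBorelSpace γ] [Nonempty γ] [MeasurableSpace δ]
    (μ : Measure Ω) [IsFiniteMeasure μ] (X : Ω → β) (Y : Ω → γ) (Z : Ω → δ) : ℝ≥0∞ :=
  InformationTheory.klDiv (μ.map fun ω => (Z ω, (X ω, Y ω)))
    ((μ.map Z) ⊗ₘ ((condDistrib X Z μ) ×ₖ (condDistrib Y Z μ)))

variable {A : Type*} [Fintype A] {F : ℕ → Type*} [∀ t, MeasurableSpace (F t)]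
  [∀ t, StandardBorelSpace (F t)] [∀ t, Nonempty (F t)]

/-- Incremental predictive information
`Δ_t(α) = I(α_{t+2:∞}; R_{t+1} | R_{1:t})` of a bandit `R` with action set `A`. -/
def incrementalPredictiveInfo (μ : Measure Ω) [IsFiniteMeasure μ] (R : ℕ → Ω → A → ℝ)
    (α : ∀ t, Ω → F t) (t : ℕ) : ℝ≥0∞ :=
  condMutualInfo μ (tail α (t + 2)) (R (t + 1)) (block R 1 t)

/-- Cumulative predictive information `V_T(α) = ∑_{t=0}^{T-1} Δ_t(α)`. -/
def cumulativePredictiveInfo (μ : Measure Ω) [IsFiniteMeasure μ] (R : ℕ → Ω → A → ℝ)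
    (α : ∀ t, Ω → F t) (T : ℕ) : ℝ≥0∞ :=
  ∑ t ∈ Finset.range T, incrementalPredictiveInfo μ R α t

end PredictiveInformation

end

open PredictiveInformation

namespace PredictiveInformation

open InformationTheory Measure

/-! ### Divergence and composition products -/

section KL

/-! Conditional data processing replaces `α_{t+2:∞}` by `S_{t+2}`. By the chain rule, what `R_{t+1}`
adds about `S_{t+2}` is at most `I(S_{t+2}; R_{1:t+1}) - I(S_{t+2}; R_{1:t})`. Summing, the cost is
`I(S_{T+1}; R_{1:T})` plus the losses `I(S_{t+1}; R_{1:t}) - I(S_{t+2}; R_{1:t})`. Since `R_{1:t}`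
reaches the future only through `S_t`, each loss is at most `I(S_{t+1}; S_t | S_{t+2})`, which by
the Markov property is `I(S_{t+1}; S_t) - I(S_{t+2}; S_t)`. As `I(S_{t+2}; S_{t+1}) ≤ I(S_{t+2};
S_t) + I(S_{t+2}; S_{t+1} | S_t)`, the sum telescopes.

The carriers are `condMutualInfo_prodMk`, `condMutualInfo_block_le`,
`IsMarkovProcess.mutualInfo_add_le` and `sum_le_of_telescoping`, which avoids subtraction in `[0,
∞]`. -/

lemma klDiv_map_measurableEquiv {α β : Type*} [MeasurableSpace α] [MeasurableSpace β]
    (μ ν : Measure α) [IsFiniteMeasure μ] [IsFiniteMeasure ν] (e : α ≃ᵐ β) :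
    klDiv (μ.map e) (ν.map e) = klDiv μ ν := by
  refine le_antisymm (klDiv_map_le μ ν e.measurable) ?_
  have h := klDiv_map_le (μ.map e) (ν.map e) e.symm.measurable
  simpa [Measure.map_map e.symm.measurable e.measurable] using h

/-- The equivalence `((a, b), c) ↦ ((a, c), b)`. -/
def prodRightComm (α β γ : Type*) [MeasurableSpace α] [MeasurableSpace β] [MeasurableSpace γ] :
    (α × β) × γ ≃ᵐ (α × γ) × β where
  toFun p := ((p.1.1, p.2), p.1.2)
  invFun p := ((p.1.1, p.2), p.1.2)
  left_inv _ := rfl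
  right_inv _ := rfl
  measurable_toFun := by simp only [Equiv.coe_fn_mk]; fun_prop
  measurable_invFun := by simp only [Equiv.coe_fn_symm_mk]; fun_prop

variable {α β γ : Type*} [MeasurableSpace α] [MeasurableSpace β] [MeasurableSpace γ]

/-- The value on boxes is symmetric in `κ` and `η`, which is why the order of the two kernels does
not matter below. -/
lemma compProd_prodMkRight_apply_prod (m : Measure α) [IsFiniteMeasure m] (κ : Kernel α β)
    (η : Kernel α γ) [IsMarkovKernel κ] [IsMarkovKernel η] {s : Set α} {t : Set β} {u : Set γ}
    (hs : MeasurableSet s) (ht : MeasurableSet t) (hu : MeasurableSet u) :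
    ((m ⊗ₘ κ) ⊗ₘ η.prodMkRight β) ((s ×ˢ t) ×ˢ u) = ∫⁻ a in s, κ a t * η a u ∂m := by
  rw [compProd_apply_prod (hs.prod ht) hu]
  simp only [Kernel.prodMkRight_apply]
  rw [setLIntegral_compProd (f := fun p => η p.1 u)
    ((η.measurable_coe hu).comp measurable_fst) hs ht]
  simp [mul_comm]

lemma map_prodRightComm_compProd (m : Measure α) [IsFiniteMeasure m] (κ : Kernel α β)
    (η : Kernel α γ) [IsMarkovKernel κ] [IsMarkovKernel η] :
    ((m ⊗ₘ κ) ⊗ₘ η.prodMkRight β).map (prodRightComm α β γ) = (m ⊗ₘ η) ⊗ₘ κ.prodMkRight γ := by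
  refine Measure.ext_prod₃' fun {s t u} hs ht hu => ?_
  rw [MeasurableEquiv.map_apply, compProd_prodMkRight_apply_prod m η κ hs ht hu]
  have : (prodRightComm α β γ) ⁻¹' ((s ×ˢ t) ×ˢ u) = (s ×ˢ u) ×ˢ t := by
    ext p; simp [prodRightComm, and_right_comm]
  rw [this, compProd_prodMkRight_apply_prod m κ η hs hu ht]
  simp [mul_comm]

lemma map_prodAssoc_compProd (m : Measure α) [IsFiniteMeasure m] (κ : Kernel α β)
    (η : Kernel α γ) [IsMarkovKernel κ] [IsMarkovKernel η] :
    ((m ⊗ₘ κ) ⊗ₘ η.prodMkRight β).map MeasurableEquiv.prodAssoc = m ⊗ₘ (κ ×ₖ η) := by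
  refine Measure.ext_prod₃ fun {s t u} hs ht hu => ?_
  rw [MeasurableEquiv.map_apply, compProd_apply_prod hs (ht.prod hu)]
  have : MeasurableEquiv.prodAssoc ⁻¹' (s ×ˢ t ×ˢ u) = (s ×ˢ t) ×ˢ u := by
    ext p; simp [MeasurableEquiv.prodAssoc, and_assoc]
  rw [this, compProd_prodMkRight_apply_prod m κ η hs ht hu]
  simp [Kernel.prod_apply_prod]

end KL

/-! ### Calculus of conditional mutual information -/

section CondMutualInfo

variable {Ω α β γ δ : Type*} [MeasurableSpace Ω] {μ : Measure Ω} [IsProbabilityMeasure μ]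
  [MeasurableSpace α] [StandardBorelSpace α] [Nonempty α]
  [MeasurableSpace β] [StandardBorelSpace β] [Nonempty β]
  [MeasurableSpace γ] [StandardBorelSpace γ] [Nonempty γ] [MeasurableSpace δ]
  {X : Ω → α} {Y : Ω → β} {W : Ω → γ} {Z : Ω → δ}

/-- Writing the reference law as a composition product over `(Z, X)` makes the chain rule for
divergence applicable. -/
lemma condMutualInfo_eq_klDiv_compProd (hX : Measurable X) (hY : Measurable Y)
    (hZ : Measurable Z) :
    condMutualInfo μ X Y Z = klDiv (μ.map fun ω => ((Z ω, X ω), Y ω))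
      ((μ.map fun ω => (Z ω, X ω)) ⊗ₘ (condDistrib Y Z μ).prodMkRight α) := by
  rw [← klDiv_map_measurableEquiv _ _ MeasurableEquiv.prodAssoc,
    ← compProd_map_condDistrib hX.aemeasurable, map_prodAssoc_compProd,
    Measure.map_map (by fun_prop) (by fun_prop)]
  rfl

lemma condMutualInfo_eq_klDiv_compProd' (hX : Measurable X) (hY : Measurable Y)
    (hZ : Measurable Z) :
    condMutualInfo μ X Y Z = klDiv (μ.map fun ω => ((Z ω, Y ω), X ω))
      ((μ.map fun ω => (Z ω, Y ω)) ⊗ₘ (condDistrib X Z μ).prodMkRight β) := by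
  rw [condMutualInfo_eq_klDiv_compProd hX hY hZ,
    ← klDiv_map_measurableEquiv _ _ (prodRightComm δ α β),
    ← compProd_map_condDistrib hX.aemeasurable, map_prodRightComm_compProd,
    compProd_map_condDistrib hY.aemeasurable, Measure.map_map (by fun_prop) (by fun_prop)]
  rfl

lemma condMutualInfo_comm (hX : Measurable X) (hY : Measurable Y) (hZ : Measurable Z) :
    condMutualInfo μ X Y Z = condMutualInfo μ Y X Z := by
  rw [condMutualInfo_eq_klDiv_compProd hX hY hZ, condMutualInfo_eq_klDiv_compProd' hY hX hZ]

/-- Data processing for `id × g`: it carries one reference law to the other because the conditional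
law of `g ∘ Y` is the image under `g` of that of `Y`. -/
lemma condMutualInfo_comp_right_le (hX : Measurable X) (hY : Measurable Y) (hZ : Measurable Z)
    {g : β → γ} (hg : Measurable g) :
    condMutualInfo μ X (fun ω => g (Y ω)) Z ≤ condMutualInfo μ X Y Z := by
  rw [condMutualInfo_eq_klDiv_compProd hX hY hZ,
    condMutualInfo_eq_klDiv_compProd hX (Y := fun ω => g (Y ω)) (hg.comp hY) hZ]
  have h := klDiv_map_le (μ.map fun ω => ((Z ω, X ω), Y ω))
    ((μ.map fun ω => (Z ω, X ω)) ⊗ₘ (condDistrib Y Z μ).prodMkRight α)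
    (g := Prod.map id g) (by fun_prop)
  rw [Measure.map_map (by fun_prop) (by fun_prop), ← Measure.compProd_map hg] at h
  convert h using 2
  · rfl
  refine Measure.compProd_congr ?_
  have h1 : condDistrib (g ∘ Y) Z μ =ᵐ[(μ.map fun ω => (Z ω, X ω)).map Prod.fst]
      (condDistrib Y Z μ).map g := by
    rw [Measure.map_map (by fun_prop) (by fun_prop)]
    exact condDistrib_comp Z hY.aemeasurable hg
  filter_upwards [ae_of_ae_map measurable_fst.aemeasurable h1] with p hp
  rw [Kernel.map_apply _ hg, Kernel.prodMkRight_apply, Kernel.prodMkRight_apply,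
    ← Kernel.map_apply _ hg, ← hp]
  rfl

lemma condMutualInfo_comp_left_le (hX : Measurable X) (hY : Measurable Y) (hZ : Measurable Z)
    {f : α → γ} (hf : Measurable f) :
    condMutualInfo μ (fun ω => f (X ω)) Y Z ≤ condMutualInfo μ X Y Z := by
  rw [condMutualInfo_comm hX hY hZ, condMutualInfo_comm (X := fun ω => f (X ω)) (hf.comp hX) hY hZ]
  exact condMutualInfo_comp_right_le hY hX hZ hf

lemma condDistrib_measurableEquiv {ε : Type*} [MeasurableSpace ε] (hX : Measurable X)
    (hZ : Measurable Z) (e : δ ≃ᵐ ε) :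
    condDistrib X (fun ω => e (Z ω)) μ =ᵐ[μ.map fun ω => e (Z ω)]
      (condDistrib X Z μ).comap e.symm e.symm.measurable := by
  refine condDistrib_ae_eq_of_measure_eq_compProd _ hX.aemeasurable ?_
  refine Measure.ext_prod fun {s t} hs ht => ?_
  rw [compProd_apply_prod hs ht, Measure.map_apply (by fun_prop) (hs.prod ht),
    ← Function.comp_def e Z, ← Measure.map_map e.measurable hZ, MeasurableEquiv.restrict_map,
    lintegral_map_equiv]
  simp only [Kernel.comap_apply, MeasurableEquiv.symm_apply_apply]
  rw [← compProd_apply_prod (e.measurable hs) ht, compProd_map_condDistrib hX.aemeasurable,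
    Measure.map_apply (by fun_prop) ((e.measurable hs).prod ht)]
  rfl

lemma condMutualInfo_measurableEquiv {ε : Type*} [MeasurableSpace ε] (hX : Measurable X)
    (hY : Measurable Y) (hZ : Measurable Z) (e : δ ≃ᵐ ε) :
    condMutualInfo μ X Y (fun ω => e (Z ω)) = condMutualInfo μ X Y Z := by
  rw [condMutualInfo, condMutualInfo,
    ← klDiv_map_measurableEquiv _ _ (e.prodCongr (MeasurableEquiv.refl (α × β))),
    Measure.map_map (by fun_prop) (by fun_prop)]
  congr 1
  have h : (condDistrib X (fun ω => e (Z ω)) μ ×ₖ condDistrib Y (fun ω => e (Z ω)) μ)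
      =ᵐ[μ.map fun ω => e (Z ω)]
      (condDistrib X Z μ ×ₖ condDistrib Y Z μ).comap e.symm e.symm.measurable := by
    filter_upwards [condDistrib_measurableEquiv (μ := μ) hX hZ e,
      condDistrib_measurableEquiv (μ := μ) hY hZ e] with a h1 h2
    rw [Kernel.prod_apply, h1, h2, Kernel.comap_apply, Kernel.comap_apply, Kernel.comap_apply,
      Kernel.prod_apply]
  rw [Measure.compProd_congr h]
  refine Measure.ext_prod fun {s t} hs ht => ?_
  rw [compProd_apply_prod hs ht, MeasurableEquiv.map_apply,
    ← Function.comp_def e Z, ← Measure.map_map e.measurable hZ, MeasurableEquiv.restrict_map,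
    lintegral_map_equiv]
  simp only [Kernel.comap_apply, MeasurableEquiv.symm_apply_apply]
  rw [← compProd_apply_prod (e.measurable hs) ht]
  rfl

/-- Chain rule for conditional mutual information. -/
lemma condMutualInfo_prodMk (hX : Measurable X) (hY : Measurable Y) (hW : Measurable W)
    (hZ : Measurable Z) :
    condMutualInfo μ X (fun ω => (Y ω, W ω)) Z =
      condMutualInfo μ X Y Z + condMutualInfo μ X W (fun ω => (Z ω, Y ω)) := by
  have hassoc : ((μ.map fun ω => ((Z ω, Y ω), W ω)) ⊗ₘ
      ((condDistrib X Z μ).prodMkRight β).prodMkRight γ).map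
      ((MeasurableEquiv.prodAssoc (α := δ) (β := β) (γ := γ)).prodCongr (MeasurableEquiv.refl α)) =
      (μ.map fun ω => (Z ω, (Y ω, W ω))) ⊗ₘ (condDistrib X Z μ).prodMkRight (β × γ) := by
    refine Measure.ext_prod fun {s t} hs ht => ?_
    have hm : (μ.map fun ω => (Z ω, (Y ω, W ω))) =
        (μ.map fun ω => ((Z ω, Y ω), W ω)).map MeasurableEquiv.prodAssoc := by
      rw [Measure.map_map (by fun_prop) (by fun_prop)]; rfl
    rw [compProd_apply_prod hs ht, MeasurableEquiv.map_apply, hm, MeasurableEquiv.restrict_map,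
      lintegral_map_equiv]
    exact compProd_apply_prod (MeasurableEquiv.prodAssoc.measurable hs) ht
  rw [condMutualInfo_eq_klDiv_compProd' hX (hY.prodMk hW) hZ,
    condMutualInfo_eq_klDiv_compProd' hX hY hZ,
    condMutualInfo_eq_klDiv_compProd hX hW (hZ.prodMk hY), ← hassoc]
  have hl : (μ.map fun ω => ((Z ω, (Y ω, W ω)), X ω)) =
      (μ.map fun ω => (((Z ω, Y ω), W ω), X ω)).map
      ((MeasurableEquiv.prodAssoc (α := δ) (β := β) (γ := γ)).prodCongr (MeasurableEquiv.refl α))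
      := by
    rw [Measure.map_map (by fun_prop) (by fun_prop)]; rfl
  -- With `W` moved last, both laws are composition products over `((Z, Y), X)`. The divergence of
  -- the bases is the first summand, that of the kernels the second.
  rw [hl, klDiv_map_measurableEquiv, ← klDiv_map_measurableEquiv _ _ (prodRightComm (δ × β) γ α),
    ← compProd_map_condDistrib (X := fun ω => (Z ω, Y ω)) hW.aemeasurable,
    map_prodRightComm_compProd, Measure.map_map (by fun_prop) (by fun_prop)]
  change klDiv (μ.map fun ω => (((Z ω, Y ω), X ω), W ω)) _ = _
  rw [← compProd_map_condDistrib (X := fun ω => ((Z ω, Y ω), X ω)) hW.aemeasurable,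
    klDiv_compProd_eq_add]

lemma mutualInfo_eq_condMutualInfo_unit (hX : Measurable X) (hY : Measurable Y) :
    mutualInfo μ X Y = condMutualInfo μ X Y (fun _ => ()) := by
  have key (ν : Measure (α × β)) [IsFiniteMeasure ν] :
      ν.map (Prod.mk ()) = ν.map (MeasurableEquiv.punitProd (α := α × β)).symm := rfl
  have hX' : condDistrib X (fun _ => ()) μ () = μ.map X := by
    have h := condDistrib_comp_map (μ := μ) (X := fun _ : Ω => ()) (by fun_prop) hX.aemeasurable
    simpa [Measure.dirac_bind (Kernel.measurable _)] using h
  have hY' : condDistrib Y (fun _ => ()) μ () = μ.map Y := by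
    have h := condDistrib_comp_map (μ := μ) (X := fun _ : Ω => ()) (by fun_prop) hY.aemeasurable
    simpa [Measure.dirac_bind (Kernel.measurable _)] using h
  have := Measure.isProbabilityMeasure_map (μ := μ) hX.aemeasurable
  have := Measure.isProbabilityMeasure_map (μ := μ) hY.aemeasurable
  rw [condMutualInfo, mutualInfo, Measure.map_const, measure_univ, one_smul,
    Measure.dirac_unit_compProd, Kernel.prod_apply, hX', hY', key,
    ← klDiv_map_measurableEquiv _ _ (MeasurableEquiv.punitProd (α := α × β)).symm,
    Measure.map_map (by fun_prop) (by fun_prop)]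
  rfl

lemma mutualInfo_comm (hX : Measurable X) (hY : Measurable Y) :
    mutualInfo μ X Y = mutualInfo μ Y X := by
  rw [mutualInfo_eq_condMutualInfo_unit hX hY, mutualInfo_eq_condMutualInfo_unit hY hX,
    condMutualInfo_comm hX hY measurable_const]

lemma mutualInfo_comp_right_le (hX : Measurable X) (hY : Measurable Y)
    {g : β → γ} (hg : Measurable g) :
    mutualInfo μ X (fun ω => g (Y ω)) ≤ mutualInfo μ X Y := by
  rw [mutualInfo_eq_condMutualInfo_unit hX hY,
    mutualInfo_eq_condMutualInfo_unit (Y := fun ω => g (Y ω)) hX (hg.comp hY)]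
  exact condMutualInfo_comp_right_le hX hY measurable_const hg

/-- Chain rule for mutual information. -/
lemma mutualInfo_prodMk (hX : Measurable X) (hY : Measurable Y) (hW : Measurable W) :
    mutualInfo μ X (fun ω => (Y ω, W ω)) = mutualInfo μ X Y + condMutualInfo μ X W Y := by
  rw [mutualInfo_eq_condMutualInfo_unit hX hY,
    mutualInfo_eq_condMutualInfo_unit hX (hY.prodMk hW),
    condMutualInfo_prodMk hX hY hW measurable_const,
    -- Conditioning on `Y` is the same as conditioning on `((), Y)`.
    ← condMutualInfo_measurableEquiv hX hW hY (MeasurableEquiv.punitProd (α := β)).symm]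
  rfl

lemma condDistrib_ae_eq_ofReal_condProb (hX : Measurable X) (hZ : Measurable Z) {s : Set α}
    (hs : MeasurableSet s) :
    (fun ω => condDistrib X Z μ (Z ω) s) =ᵐ[μ] fun ω => ENNReal.ofReal (condProb μ X s Z ω) := by
  filter_upwards [condDistrib_ae_eq_condExp (μ := μ) hZ hX hs] with ω hω
  rw [condProb, ← hω, ofReal_measureReal]

lemma setLIntegral_ofReal_condProb {ξ : Type*} [MeasurableSpace ξ] {X : Ω → ξ}
    (hX : Measurable X) (hZ : Measurable Z) {s : Set ξ}
    (hs : MeasurableSet s) {u : Set δ} (hu : MeasurableSet u) :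
    ∫⁻ ω in Z ⁻¹' u, ENNReal.ofReal (condProb μ X s Z ω) ∂μ = μ (Z ⁻¹' u ∩ X ⁻¹' s) := by
  have h0 : 0 ≤ᵐ[μ] condProb μ X s Z :=
    condExp_nonneg (ae_of_all _ fun ω => Set.indicator_nonneg (fun _ _ => zero_le_one) ω)
  have hint : Integrable ((X ⁻¹' s).indicator fun _ => (1 : ℝ)) μ :=
    (integrable_const _).indicator (hX hs)
  rw [condProb] at h0
  simp only [condProb]
  rw [← ofReal_integral_eq_lintegral_ofReal integrable_condExp.integrableOn
    (ae_restrict_of_ae h0), setIntegral_condExp hZ.comap_le hint ⟨u, hu, rfl⟩,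
    integral_indicator (hX hs), Measure.restrict_restrict (hX hs), Set.inter_comm]
  simp

/-- If the conditional law of `X` given a random element `B` that determines `Z` and `Y` is that
given `Z`, then `X` and `Y` have zero conditional mutual information given `Z`. -/
lemma condMutualInfo_eq_zero_of_condProb_eq {ε : Type*} [MeasurableSpace ε] {B : Ω → ε}
    (hX : Measurable X) (hB : Measurable B) {f : ε → δ} (hf : Measurable f) {g : ε → β}
    (hg : Measurable g)
    (h : ∀ s, MeasurableSet s → condProb μ X s B =ᵐ[μ] condProb μ X s (fun ω => f (B ω))) :
    condMutualInfo μ X (fun ω => g (B ω)) (fun ω => f (B ω)) = 0 := by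
  have hZ : Measurable fun ω => f (B ω) := hf.comp hB
  have hY : Measurable fun ω => g (B ω) := hg.comp hB
  rw [condMutualInfo_eq_klDiv_compProd' hX hY hZ, klDiv_eq_zero_iff]
  have := Measure.isProbabilityMeasure_map (μ := μ) (hZ.prodMk hY).aemeasurable
  refine Measure.ext_prod₃' fun {s t u} hs ht hu => ?_
  have hst := (hf.prodMk hg) (hs.prod ht)
  rw [Measure.map_apply (by fun_prop) ((hs.prod ht).prod hu),
    compProd_apply_prod (hs.prod ht) hu, setLIntegral_map (hs.prod ht)
      (Kernel.measurable_coe _ hu) (hZ.prodMk hY)]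
  simp only [Kernel.prodMkRight_apply]
  -- The domain of integration is a `σ(B)`-event, so once the law given `Z` is replaced by the law
  -- given `B`, the integral is a joint probability.
  rw [lintegral_congr_ae (ae_restrict_of_ae
    ((condDistrib_ae_eq_ofReal_condProb hX hZ hu).trans ((h u hu).symm.fun_comp ENNReal.ofReal)))]
  exact (setLIntegral_ofReal_condProb hX hB hu hst).symm

/-- On boxes both laws are integrals over a `Z`-event, and the hypothesis equates the integrands. -/
lemma condMutualInfo_eq_zero_of_condIndepRV (hX : Measurable X) (hY : Measurable Y)
    (hZ : Measurable Z) (h : CondIndepRV μ X Y Z) :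
    condMutualInfo μ X Y Z = 0 := by
  rw [condMutualInfo, klDiv_eq_zero_iff]
  have := Measure.isProbabilityMeasure_map (μ := μ) (hZ.prodMk (hX.prodMk hY)).aemeasurable
  refine Measure.ext_prod₃ fun {u s t} hu hs ht => ?_
  rw [compProd_apply_prod hu (hs.prod ht), setLIntegral_map hu
    (Kernel.measurable_coe _ (hs.prod ht)) hZ, Measure.map_apply (by fun_prop)
    (hu.prod (hs.prod ht))]
  refine (setLIntegral_ofReal_condProb (hX.prodMk hY) hZ (hs.prod ht) hu).symm.trans ?_
  refine lintegral_congr_ae (ae_restrict_of_ae ?_)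
  have h0 : 0 ≤ᵐ[μ] condProb μ X s Z :=
    condExp_nonneg (ae_of_all _ fun ω => Set.indicator_nonneg (fun _ _ => zero_le_one) ω)
  filter_upwards [h s t hs ht, condDistrib_ae_eq_ofReal_condProb (μ := μ) hX hZ hs,
    condDistrib_ae_eq_ofReal_condProb (μ := μ) hY hZ ht, h0] with ω h1 h2 h3 h4
  rw [h1, Kernel.prod_apply_prod, h2, h3, ENNReal.ofReal_mul h4]

end CondMutualInfo

/-! ### Blocks, tails and the Markov property -/

section Measurability

variable {Ω : Type*} [MeasurableSpace Ω] {E : ℕ → Type*} [∀ t, MeasurableSpace (E t)]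
  {X : ∀ t, Ω → E t}

lemma measurable_block {i : ℕ} (hX : ∀ t, i ≤ t → Measurable (X t)) (j : ℕ) :
    Measurable (block X i j) :=
  measurable_pi_lambda _ fun k => hX k k.2.1

lemma measurable_tail {i : ℕ} (hX : ∀ t, i ≤ t → Measurable (X t)) : Measurable (tail X i) :=
  measurable_pi_lambda _ fun k => hX k k.2

/-- A Markov process satisfies `S_{t+2} ⊥ S_t | S_{t+1}`. -/
lemma IsMarkovProcess.condMutualInfo_eq_zero {μ : Measure Ω} [IsProbabilityMeasure μ]
    [∀ t, StandardBorelSpace (E t)] [∀ t, Nonempty (E t)] (h : IsMarkovProcess μ X)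
    (hX : ∀ t, 1 ≤ t → Measurable (X t)) {t : ℕ} (ht : 1 ≤ t) :
    condMutualInfo μ (X (t + 2)) (X t) (X (t + 1)) = 0 :=
  -- The history `S_{1:t+1}` determines both `S_{t+1}` and `S_t`.
  condMutualInfo_eq_zero_of_condProb_eq (hX _ (by lia)) (measurable_block hX (t + 1))
    (measurable_pi_apply (⟨t + 1, by simp⟩ : Set.Icc 1 (t + 1)))
    (measurable_pi_apply (⟨t, by simp [ht]⟩ : Set.Icc 1 (t + 1))) (h (t + 1) (by lia))

end Measurability

/-! ### Information inequalities for rewards and states -/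

section Bounds

variable {Ω : Type*} [MeasurableSpace Ω] {μ : Measure Ω} [IsProbabilityMeasure μ]
  {A : Type*} [Fintype A]
  {E : ℕ → Type*} [∀ t, MeasurableSpace (E t)] [∀ t, StandardBorelSpace (E t)]
  [∀ t, Nonempty (E t)]
  {F : ℕ → Type*} [∀ t, MeasurableSpace (F t)] [∀ t, StandardBorelSpace (F t)]
  [∀ t, Nonempty (F t)]
  {R : ℕ → Ω → A → ℝ} {α : ∀ t, Ω → F t} {S : ∀ t, Ω → E t}

/-- Conditional data processing: `I(X; Y | Z) ≤ I(W; Y | Z)` if `X ⊥ Y | (W, Z)`. -/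
lemma condMutualInfo_le_of_condIndepRV {β γ δ ε : Type*}
    [MeasurableSpace β] [StandardBorelSpace β] [Nonempty β]
    [MeasurableSpace γ] [StandardBorelSpace γ] [Nonempty γ]
    [MeasurableSpace ε] [StandardBorelSpace ε] [Nonempty ε] [MeasurableSpace δ]
    {X : Ω → β} {Y : Ω → γ} {W : Ω → ε} {Z : Ω → δ} (hX : Measurable X) (hY : Measurable Y)
    (hW : Measurable W) (hZ : Measurable Z)
    (h : CondIndepRV μ X Y (fun ω => (W ω, Z ω))) :
    condMutualInfo μ X Y Z ≤ condMutualInfo μ W Y Z := by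
  have h0 := condMutualInfo_eq_zero_of_condIndepRV hX hY (hW.prodMk hZ) h
  have h1 := condMutualInfo_measurableEquiv hX hY (hW.prodMk hZ) MeasurableEquiv.prodComm (μ := μ)
  rw [h0, condMutualInfo_comm hX hY (by fun_prop)] at h1
  have h2 := condMutualInfo_prodMk hY hW hX hZ (μ := μ)
  erw [h1, add_zero] at h2
  rw [condMutualInfo_comm hX hY hZ, condMutualInfo_comm hW hY hZ, ← h2]
  exact condMutualInfo_comp_right_le hY (hW.prodMk hX) hZ measurable_snd

lemma incrementalPredictiveInfo_le (hR : ∀ t, 1 ≤ t → Measurable (R t))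
    (hα : ∀ t, 1 ≤ t → Measurable (α t)) (hS : ∀ t, 1 ≤ t → Measurable (S t)) {t : ℕ}
    (hαR : CondIndepRV μ (tail α (t + 2)) (R (t + 1)) (fun ω => (S (t + 2) ω, block R 1 t ω))) :
    incrementalPredictiveInfo μ R α t ≤
      condMutualInfo μ (S (t + 2)) (R (t + 1)) (block R 1 t) :=
  condMutualInfo_le_of_condIndepRV (measurable_tail fun k hk => hα k (by lia)) (hR _ (by lia))
    (hS _ (by lia)) (measurable_block hR t) hαR

/-- Appending `R_{t+1}` to the block `R_{1:t}`. -/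
lemma mutualInfo_block_add_le {β : Type*} [MeasurableSpace β] [StandardBorelSpace β] [Nonempty β]
    {X : Ω → β} (hX : Measurable X) (hR : ∀ t, 1 ≤ t → Measurable (R t)) (t : ℕ) :
    mutualInfo μ X (block R 1 t) + condMutualInfo μ X (R (t + 1)) (block R 1 t) ≤
      mutualInfo μ X (block R 1 (t + 1)) := by
  rw [← mutualInfo_prodMk hX (measurable_block hR t) (hR _ (by lia))]
  let g : (Set.Icc 1 (t + 1) → A → ℝ) → (Set.Icc 1 t → A → ℝ) × (A → ℝ) :=
    fun x => (fun k => x ⟨k, k.2.1, k.2.2.trans (by lia)⟩, x ⟨t + 1, by simp⟩)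
  exact mutualInfo_comp_right_le hX (measurable_block hR (t + 1)) (g := g) (by fun_prop)

/-- Independence of the whole future passes to any function of it; it is needed for `S_{t+1}` and
for `(S_{t+2}, S_{t+1})`. -/
lemma condMutualInfo_block_eq_zero (hR : ∀ t, 1 ≤ t → Measurable (R t))
    (hS : ∀ t, 1 ≤ t → Measurable (S t)) {t : ℕ} (ht : 1 ≤ t)
    (hSR : CondIndepRV μ (tail S (t + 1)) (block R 1 t) (S t)) {β : Type*} [MeasurableSpace β]
    [StandardBorelSpace β] [Nonempty β] {f : (∀ k : Set.Ici (t + 1), E k) → β}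
    (hf : Measurable f) :
    condMutualInfo μ (fun ω => f (tail S (t + 1) ω)) (block R 1 t) (S t) = 0 := by
  have hT : Measurable (tail S (t + 1)) := measurable_tail fun k hk => hS k (by lia)
  refine le_antisymm ?_ zero_le
  rw [← condMutualInfo_eq_zero_of_condIndepRV hT (measurable_block hR t) (hS t ht) hSR]
  exact condMutualInfo_comp_left_le hT (measurable_block hR t) (hS t ht) hf

/-- `I(S_{t+1}; R_{1:t}) ≤ I(S_{t+1}; S_t)`. -/
lemma mutualInfo_block_le (hR : ∀ t, 1 ≤ t → Measurable (R t))
    (hS : ∀ t, 1 ≤ t → Measurable (S t)) {t : ℕ} (ht : 1 ≤ t)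
    (hSR : CondIndepRV μ (tail S (t + 1)) (block R 1 t) (S t)) :
    mutualInfo μ (S (t + 1)) (block R 1 t) ≤ mutualInfo μ (S (t + 1)) (S t) := by
  have h := mutualInfo_prodMk (hS (t + 1) (by lia)) (hS t ht) (measurable_block hR t) (μ := μ)
  have h0 : condMutualInfo μ (S (t + 1)) (block R 1 t) (S t) = 0 :=
    condMutualInfo_block_eq_zero hR hS ht hSR
      (measurable_pi_apply (⟨t + 1, by simp⟩ : Set.Ici (t + 1)))
  rw [h0, add_zero] at h
  rw [← h]
  exact mutualInfo_comp_right_le (hS (t + 1) (by lia)) ((hS t ht).prodMk (measurable_block hR t))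
    measurable_snd

/-- `I(S_{t+1}; R_{1:t} | S_{t+2}) ≤ I(S_{t+1}; S_t | S_{t+2})`. -/
lemma condMutualInfo_block_le (hR : ∀ t, 1 ≤ t → Measurable (R t))
    (hS : ∀ t, 1 ≤ t → Measurable (S t)) {t : ℕ} (ht : 1 ≤ t)
    (hSR : CondIndepRV μ (tail S (t + 1)) (block R 1 t) (S t)) :
    condMutualInfo μ (S (t + 1)) (block R 1 t) (S (t + 2)) ≤
      condMutualInfo μ (S (t + 1)) (S t) (S (t + 2)) := by
  have h0 := hS t ht
  have h1 := hS (t + 1) (by lia)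
  have h2 := hS (t + 2) (by lia)
  have hB := measurable_block hR t
  have hz : condMutualInfo μ (fun ω => (S (t + 2) ω, S (t + 1) ω)) (block R 1 t) (S t) = 0 :=
    condMutualInfo_block_eq_zero hR hS ht hSR
      (f := fun x => (x ⟨t + 2, by simp⟩, x ⟨t + 1, by simp⟩)) (by fun_prop)
  -- Splitting this zero by the chain rule shows that `R_{1:t}` is uninformative about `S_{t+1}`
  -- given `(S_t, S_{t+2})`.
  rw [condMutualInfo_comm (h2.prodMk h1) hB h0, condMutualInfo_prodMk hB h2 h1 h0] at hz
  have hz' := (add_eq_zero.1 hz).2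
  have he := condMutualInfo_measurableEquiv hB h1 (h0.prodMk h2) MeasurableEquiv.prodComm (μ := μ)
  rw [hz', condMutualInfo_comm hB h1 (by fun_prop)] at he
  have h := condMutualInfo_prodMk h1 h0 hB h2 (μ := μ)
  erw [he, add_zero] at h
  rw [← h]
  exact condMutualInfo_comp_right_le h1 (h0.prodMk hB) h2 measurable_snd

/-- `I(X; Y) ≤ I(X; Z) + I(X; Y | Z)`. -/
lemma mutualInfo_le_add_condMutualInfo {β γ δ : Type*}
    [MeasurableSpace β] [StandardBorelSpace β] [Nonempty β]
    [MeasurableSpace γ] [StandardBorelSpace γ] [Nonempty γ]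
    [MeasurableSpace δ] [StandardBorelSpace δ] [Nonempty δ]
    {X : Ω → β} {Y : Ω → γ} {Z : Ω → δ} (hX : Measurable X) (hY : Measurable Y)
    (hZ : Measurable Z) :
    mutualInfo μ X Y ≤ mutualInfo μ X Z + condMutualInfo μ X Y Z := by
  rw [← mutualInfo_prodMk hX hZ hY]
  exact mutualInfo_comp_right_le hX (hZ.prodMk hY) measurable_snd

/-- `I(S_{t+2}; S_t) + I(S_{t+1}; S_t | S_{t+2}) ≤ I(S_{t+1}; S_t)` for a Markov process. -/
lemma IsMarkovProcess.mutualInfo_add_le (hMarkov : IsMarkovProcess μ S)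
    (hS : ∀ t, 1 ≤ t → Measurable (S t)) {t : ℕ} (ht : 1 ≤ t) :
    mutualInfo μ (S (t + 2)) (S t) + condMutualInfo μ (S (t + 1)) (S t) (S (t + 2)) ≤
      mutualInfo μ (S (t + 1)) (S t) := by
  have h0 := hS t ht
  have h1 := hS (t + 1) (by lia)
  have h2 := hS (t + 2) (by lia)
  have hz := hMarkov.condMutualInfo_eq_zero hS ht
  rw [condMutualInfo_comm h2 h0 h1] at hz
  -- Expand `I(S_t; S_{t+1}, S_{t+2})` in both orders; the Markov property kills one term.
  have h := mutualInfo_prodMk h0 h1 h2 (μ := μ)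
  rw [hz, add_zero] at h
  rw [mutualInfo_comm h2 h0, condMutualInfo_comm h1 h0 h2, mutualInfo_comm h1 h0,
    ← mutualInfo_prodMk h0 h2 h1, ← h]
  exact mutualInfo_comp_right_le h0 (h1.prodMk h2) measurable_swap

end Bounds

/-! ### Telescoping and conclusion -/

/-- Telescoping bound. In the application, `a_t = I(S_{t+1}; S_t)`, `b_t = I(S_{t+2}; S_t)`,
`c_t = I(S_{t+2}; S_{t+1} | S_t)`, `d_t = I(S_{t+1}; S_t | S_{t+2})`, `r_t = I(S_{t+1}; R_{1:t})`,
`q_t = I(S_{t+2}; R_{1:t})`, `v_t = I(S_{t+2}; R_{t+1} | R_{1:t})`. -/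
lemma sum_le_of_telescoping {a b c d r q v : ℕ → ℝ≥0∞}
    (hac : ∀ t, 1 ≤ t → a (t + 1) ≤ b t + c t) (hbd : ∀ t, 1 ≤ t → b t + d t ≤ a t)
    (hrq : ∀ t, 1 ≤ t → r t ≤ q t + d t) (hqv : ∀ t, q t + v t ≤ r (t + 1))
    (hra : ∀ t, 1 ≤ t → r t ≤ a t) {T : ℕ} (hT : 1 ≤ T) :
    ∑ t ∈ Finset.range T, v t ≤ a 1 + ∑ t ∈ Finset.Ico 1 T, c t := by
  by_cases hfin : a 1 + ∑ t ∈ Finset.Ico 1 T, c t = ∞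
  · simp [hfin]
  -- Cancelling in `[0, ∞]` needs finite terms, so finiteness of `a T` travels with the induction;
  -- it gives that of `b T` and `d T`. The term `r T` is traded for `a T` only at the end.
  have key : a T ≠ ∞ ∧ ∑ t ∈ Finset.range T, v t + a T ≤
      a 1 + ∑ t ∈ Finset.Ico 1 T, c t + r T := by
    induction T, hT using Nat.le_induction with
    | base =>
      have : v 0 ≤ r 1 := le_add_self.trans (hqv 0)
      simp only [Finset.Ico_self, Finset.sum_empty, add_zero] at hfin ⊢
      refine ⟨hfin, ?_⟩
      simpa [add_comm] using add_le_add_left this (a 1)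
    | succ n hn ih =>
      rw [Finset.sum_Ico_succ_top hn, ← add_assoc, ENNReal.add_eq_top, not_or] at hfin
      obtain ⟨ha, hV⟩ := ih hfin.1
      have hb : b n ≠ ∞ := ne_top_of_le_ne_top ha (le_self_add.trans (hbd n hn))
      have hd : d n ≠ ∞ := ne_top_of_le_ne_top ha (le_add_self.trans (hbd n hn))
      refine ⟨ne_top_of_le_ne_top (ENNReal.add_ne_top.2 ⟨hb, hfin.2⟩) (hac n hn), ?_⟩
      rw [Finset.sum_Ico_succ_top hn, Finset.sum_range_succ]
      set V := ∑ t ∈ Finset.range n, v t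
      set C := ∑ t ∈ Finset.Ico 1 n, c t
      have h1 : V + b n ≤ a 1 + C + q n := by
        refine (ENNReal.add_le_add_iff_right hd).1 ?_
        calc V + b n + d n = V + (b n + d n) := add_assoc _ _ _
          _ ≤ V + a n := by gcongr; exact hbd n hn
          _ ≤ a 1 + C + r n := hV
          _ ≤ a 1 + C + (q n + d n) := by gcongr; exact hrq n hn
          _ = a 1 + C + q n + d n := (add_assoc _ _ _).symm
      calc V + v n + a (n + 1) ≤ V + v n + (b n + c n) := by gcongr; exact hac n hn
        _ = (V + b n) + (c n + v n) := by ring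
        _ ≤ (a 1 + C + q n) + (c n + v n) := by gcongr
        _ = a 1 + (C + c n) + (q n + v n) := by ring
        _ ≤ a 1 + (C + c n) + r (n + 1) := by gcongr; exact hqv n
  refine (ENNReal.add_le_add_iff_right key.1).1 (key.2.trans ?_)
  gcongr
  exact hra T hT

end PredictiveInformation

theorem proposition2 {Ω : Type*} [MeasurableSpace Ω] (μ : Measure Ω) [IsProbabilityMeasure μ]
    {A : Type*} [Fintype A]
    {E : ℕ → Type*} [∀ t, MeasurableSpace (E t)] [∀ t, StandardBorelSpace (E t)]
    [∀ t, Nonempty (E t)]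
    {F : ℕ → Type*} [∀ t, MeasurableSpace (F t)] [∀ t, StandardBorelSpace (F t)]
    [∀ t, Nonempty (F t)]
    (R : ℕ → Ω → A → ℝ) (α : ∀ t, Ω → F t) (S : ∀ t, Ω → E t)
    (hR : ∀ t, 1 ≤ t → Measurable (R t))
    (hα : ∀ t, 1 ≤ t → Measurable (α t))
    (hS : ∀ t, 1 ≤ t → Measurable (S t))
    (hMarkov : IsMarkovProcess μ S)
    (hSR : ∀ t, 1 ≤ t → CondIndepRV μ (tail S (t + 1)) (block R 1 t) (S t))
    (hαR : ∀ t, CondIndepRV μ (tail α (t + 2)) (R (t + 1))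
      (fun ω => (S (t + 2) ω, block R 1 t ω)))
    (T : ℕ) (hT : 1 ≤ T) :
    cumulativePredictiveInfo μ R α T ≤
      mutualInfo μ (S 2) (S 1) +
        ∑ t ∈ Finset.Ico 1 T, condMutualInfo μ (S (t + 2)) (S (t + 1)) (S t) := by
  refine (Finset.sum_le_sum fun t _ => incrementalPredictiveInfo_le hR hα hS (hαR t)).trans ?_
  refine sum_le_of_telescoping (a := fun t => mutualInfo μ (S (t + 1)) (S t))
    (b := fun t => mutualInfo μ (S (t + 2)) (S t))
    (d := fun t => condMutualInfo μ (S (t + 1)) (S t) (S (t + 2)))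
    (r := fun t => mutualInfo μ (S (t + 1)) (block R 1 t))
    (q := fun t => mutualInfo μ (S (t + 2)) (block R 1 t))
    (fun t ht => ?_) (fun t ht => hMarkov.mutualInfo_add_le hS ht) (fun t ht => ?_)
    (fun t => mutualInfo_block_add_le (hS _ (by lia)) hR t)
    (fun t ht => mutualInfo_block_le hR hS ht (hSR t ht)) hT
  · exact mutualInfo_le_add_condMutualInfo (hS _ (by lia)) (hS _ (by lia)) (hS t ht)
  · have hB := measurable_block hR t
    have h1 := hS (t + 1) (by lia)
    have h2 := hS (t + 2) (by lia)
    -- It remains to bound `I(R_{1:t}; S_{t+1})` by inserting `S_{t+2}`.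
    refine le_trans ?_ (add_le_add_right (condMutualInfo_block_le hR hS ht (hSR t ht)) _)
    rw [mutualInfo_comm h1 hB, mutualInfo_comm h2 hB, condMutualInfo_comm h1 hB h2]
    exact mutualInfo_le_add_condMutualInfo hB h1 h2
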